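/- A pure state of two qubits is a unit vector of $\mathbb{C}^2\otimes\mathbb{C}^2$; it is a product state if it has the form $a\otimes b$, and entangled otherwise. A two-qubit unextendible entangled basis is a set $S$ of mutually orthogonal pure entangled states in $\mathbb{C}^2\otimes\mathbb{C}^2$ that spans a proper subspace and whose orthogonal complement $S^{\perp}$ contains no entangled state (every pure state in $S^{\perp}$ is a product state). A set $S$ of states is perfectly distinguishable by LOCC (local quantum operations and classical communication) if there is a protocol, in which two parties, each holding one qubit, adaptively perform local measurements in rounds and announce all outcomes, that identifies every $\psi\in S$ with probability one (the number of rounds may be unbounded, the probability then being the limit over the rounds). Proposition. Every two-qubit unextendible entangled basis has exactly three elements, and it cannot be perfectly distinguished by LOCC. In particular, one or two mutually orthogonal pure entangled two-qubit states never form an unextendible entangled basis: there is always an entangled pure state orthogonal to all of them. -/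

import Mathlib

open scoped TensorProduct

noncomputable section

/-- The state space `ℂ^d` of a `d`-level quantum system. -/
abbrev Qudit (d : ℕ) : Type := EuclideanSpace ℂ (Fin d)

/-- The state space `ℂ^dA ⊗ ℂ^dB` shared by two parties, with its tensor-product inner product. -/
abbrev Bipartite (dA dB : ℕ) : Type := Qudit dA ⊗[ℂ] Qudit dB

/-- A vector is product if it is of the form `a ⊗ b`. -/
def IsProductVec {dA dB : ℕ} (ψ : Bipartite dA dB) : Prop :=
  ∃ (a : Qudit dA) (b : Qudit dB), ψ = a ⊗ₜ[ℂ] b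

/-- A pure entangled state: a unit vector that is not a product vector. -/
def IsEntangledState {dA dB : ℕ} (ψ : Bipartite dA dB) : Prop :=
  ‖ψ‖ = 1 ∧ ¬ IsProductVec ψ

/-- A set of mutually orthogonal pure entangled states. -/
structure IsOrthogonalEntangledSet {dA dB : ℕ} (S : Set (Bipartite dA dB)) : Prop where
  entangled : ∀ ψ ∈ S, IsEntangledState ψ
  orthogonal : ∀ ψ ∈ S, ∀ φ ∈ S, ψ ≠ φ → inner ℂ ψ φ = 0

/-- An unextendible entangled basis: mutually orthogonal pure entangled states spanning a proper
subspace, such that every pure state in the complementary subspace is a product state. -/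
structure IsUnextendibleEntangledBasis {dA dB : ℕ} (S : Set (Bipartite dA dB)) : Prop
    extends IsOrthogonalEntangledSet S where
  proper : Submodule.span ℂ S ≠ ⊤
  unextendible : ∀ φ ∈ (Submodule.span ℂ S)ᗮ, ‖φ‖ = 1 → IsProductVec φ

/-- A measurement on a `d`-level system with finitely many outcomes, given by Kraus operators
`K_j : ℂ^d → ℂ^(d_j)` with `∑ j, K_j† K_j = 1`. Attaching and discarding local ancillas is
covered by the arbitrary output dimensions. -/
structure LocalMeasurement (d : ℕ) where
  outcomes : ℕ
  outDim : Fin outcomes → ℕ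
  kraus : ∀ j, Qudit d →ₗ[ℂ] Qudit (outDim j)
  complete : ∑ j, (LinearMap.adjoint (kraus j)) ∘ₗ (kraus j) = LinearMap.id

/-- One round of an LOCC protocol on `ℂ^dA ⊗ ℂ^dB`: one of the two parties performs a local
measurement and announces the outcome `j`, and the protocol moves on to `next j`. -/
inductive LOCCRound (Node : ℕ → ℕ → Type) (dA dB : ℕ) : Type
  | alice (M : LocalMeasurement dA) (next : ∀ j, Node (M.outDim j) dB)
  | bob (M : LocalMeasurement dB) (next : ∀ j, Node dA (M.outDim j))

/-- A two-party LOCC protocol with answers in `ι`. The nodes are the possible situations of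
the protocol (for instance the records of everything that has been announced so far); `Node a b`
are the nodes in which the systems of the parties have dimensions `a` and `b`. At each node, `step`
says who measures what, depending on everything announced before, and `answer` is the answer
that is given if the protocol is read out at this node. The number of rounds is not bounded;
a protocol with finitely many rounds is one that from some round on only performs the trivial
measurement and keeps its answer. -/
structure LOCCProtocol (ι : Type) (dA dB : ℕ) where
  Node : ℕ → ℕ → Type
  start : Node dA dB
  step : ∀ {a b : ℕ}, Node a b → LOCCRound Node a b
  answer : ∀ {a b : ℕ}, Node a b → ι

open Classical in
/-- The probability that the protocol, run for `n` rounds from the node `x` on the (possibly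
unnormalised) vector `ψ`, gives the answer `i`; the weight `‖ψ‖ ^ 2` is the probability with which
the unnormalised post-measurement vector `ψ` has been reached. -/
def LOCCProtocol.answerProb {ι : Type} {dA dB : ℕ} (P : LOCCProtocol ι dA dB) (i : ι) :
    ℕ → ∀ {a b : ℕ}, P.Node a b → Bipartite a b → ℝ
  | 0, _, _, x, ψ => if P.answer x = i then ‖ψ‖ ^ 2 else 0
  | n + 1, _, _, x, ψ =>
    match P.step x with
    | .alice M next =>
      ∑ j, P.answerProb i n (next j) (TensorProduct.map (M.kraus j) LinearMap.id ψ)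
    | .bob M next =>
      ∑ j, P.answerProb i n (next j) (TensorProduct.map LinearMap.id (M.kraus j) ψ)

/-- The states in `S` can be perfectly distinguished by LOCC: there is one LOCC protocol which, for
every `ψ ∈ S` as input, identifies `ψ` with probability one. For a protocol with finitely many rounds
the limit is the value of the probability after the last round; for a protocol with
unboundedly many rounds it is the probability in the limit of all rounds. -/
def LOCCPerfectlyDistinguishable {dA dB : ℕ} (S : Set (Bipartite dA dB)) : Prop :=
  ∃ P : LOCCProtocol S dA dB, ∀ ψ : S,
    Filter.Tendsto (fun n => P.answerProb ψ n P.start (ψ : Bipartite dA dB))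
      Filter.atTop (nhds 1)

end

/-! A two-qubit vector is product exactly when its coordinate matrix has determinant zero
(`isProductVec_iff_tensorDet`). Cardinality: a space of product vectors of dimension at least two
contains orthogonal nonzero `a ⊗ b`, `c ⊗ d` with product sum, which forces `a ∥ c` or `b ∥ d`;
every vector orthogonal to both is then product (`isProductVec_of_mem_orthogonal`). One or two
entangled states leave a complement of dimension at least two, so it cannot consist of product
vectors. Properness of the span excludes four states.

LOCC: after any number of rounds an answer has probability `∑ k, |⟨u k ⊗ v k, ψ⟩|²`
(`LOCCProtocol.exists_product_family`). Let `b 0` be the product state completing `S = {b 1, b 2, b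
3}` to an orthonormal basis. If the answer `b 1` were exact, each `u k ⊗ v k` would be `p • b 0 + q
• b 1`, with determinant `q (det (b 1) q + D p) = 0`. Certain detection of `b 1` makes the coherence
`∑ p q̄` vanish, so summing `q̄ (det (b 1) q + D p) = 0` gives `det (b 1) = 0`, a contradiction.
`norm_sum_inner_mul_inner_sq_le` and `norm_mul_sum_sq_le_of_quadratic` make this quantitative, so
that it survives the limit over the rounds. -/

/-! ### LOCC answers as separable effects -/

/-- The outcome probabilities of a measurement by the first party add up to one. -/
theorem LocalMeasurement.sum_norm_sq_map_left {dA dB : ℕ} (M : LocalMeasurement dA)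
    (ψ : Bipartite dA dB) :
    ∑ j, ‖TensorProduct.map (M.kraus j) (LinearMap.id : Qudit dB →ₗ[ℂ] Qudit dB) ψ‖ ^ 2
      = ‖ψ‖ ^ 2 := by
  have key : ∑ j, TensorProduct.map ((LinearMap.adjoint (M.kraus j)) ∘ₗ (M.kraus j))
      (LinearMap.id : Qudit dB →ₗ[ℂ] Qudit dB) ψ = ψ := by
    have h := congrArg (fun f => LinearMap.rTensorHom (R := ℂ) (Qudit dB) f ψ) M.complete
    rw [map_sum, LinearMap.sum_apply] at h
    simpa [LinearMap.rTensor] using h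
  rw [← inner_self_eq_norm_sq (𝕜 := ℂ) ψ]
  -- This expands `ψ` in both slots of the inner product; the next line folds the second slot back.
  conv_rhs => rw [← key, sum_inner, map_sum]
  rw [key]
  refine Finset.sum_congr rfl fun j _ => ?_
  rw [← inner_self_eq_norm_sq (𝕜 := ℂ), ← LinearMap.adjoint_inner_left, TensorProduct.adjoint_map,
    ← LinearMap.comp_apply, ← TensorProduct.map_comp]
  simp

/-- The outcome probabilities of a measurement by the second party add up to one. -/
theorem LocalMeasurement.sum_norm_sq_map_right {dA dB : ℕ} (M : LocalMeasurement dB)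
    (ψ : Bipartite dA dB) :
    ∑ j, ‖TensorProduct.map (LinearMap.id : Qudit dA →ₗ[ℂ] Qudit dA) (M.kraus j) ψ‖ ^ 2
      = ‖ψ‖ ^ 2 := by
  rw [← TensorProduct.norm_comm (𝕜 := ℂ) ψ, ← M.sum_norm_sq_map_left]
  refine Finset.sum_congr rfl fun j _ => ?_
  rw [← TensorProduct.norm_comm (𝕜 := ℂ), TensorProduct.map_comm]

/-- An outcome of an LOCC protocol is a separable effect: its probability is a sum of squared
overlaps with product vectors. -/
theorem LOCCProtocol.exists_product_family {ι : Type} {dA dB : ℕ} (P : LOCCProtocol ι dA dB)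
    (i : ι) (n : ℕ) : ∀ {a b : ℕ} (x : P.Node a b),
      ∃ (κ : Type) (_ : Fintype κ) (u : κ → Qudit a) (v : κ → Qudit b), ∀ ψ : Bipartite a b,
        P.answerProb i n x ψ = ∑ k, ‖inner ℂ (u k ⊗ₜ[ℂ] v k) ψ‖ ^ 2 := by
  induction n with
  | zero =>
    intro a b x
    by_cases h : P.answer x = i
    -- Parseval in the product basis writes `‖ψ‖ ^ 2` as a sum of product overlaps.
    · refine ⟨Fin a × Fin b, inferInstance, fun k => EuclideanSpace.basisFun _ ℂ k.1,
        fun k => EuclideanSpace.basisFun _ ℂ k.2, fun ψ => ?_⟩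
      have := ((EuclideanSpace.basisFun (Fin a) ℂ).tensorProduct
        (EuclideanSpace.basisFun (Fin b) ℂ)).sum_sq_norm_inner_right ψ
      simp only [OrthonormalBasis.tensorProduct_apply'] at this
      rw [this, LOCCProtocol.answerProb, if_pos h]
    · exact ⟨Fin 0, inferInstance, Fin.elim0, Fin.elim0,
        fun ψ => by simp [LOCCProtocol.answerProb, h]⟩
  | succ n ih =>
    intro a b x
    cases hx : P.step x with
    | alice M next =>
      choose κ fκ u v huv using fun j => ih (next j)
      -- A local Kraus operator moved to the other side of the inner product keeps product vectors
      -- product.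
      refine ⟨Σ j, κ j, inferInstance, fun k => LinearMap.adjoint (M.kraus k.1) (u k.1 k.2),
        fun k => v k.1 k.2, fun ψ => ?_⟩
      rw [LOCCProtocol.answerProb, hx, Fintype.sum_sigma]
      refine Finset.sum_congr rfl fun j _ => ?_
      rw [huv]
      refine Finset.sum_congr rfl fun k _ => ?_
      rw [← LinearMap.adjoint_inner_left, TensorProduct.adjoint_map]
      simp
    | bob M next =>
      choose κ fκ u v huv using fun j => ih (next j)
      refine ⟨Σ j, κ j, inferInstance, fun k => u k.1 k.2,
        fun k => LinearMap.adjoint (M.kraus k.1) (v k.1 k.2), fun ψ => ?_⟩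
      rw [LOCCProtocol.answerProb, hx, Fintype.sum_sigma]
      refine Finset.sum_congr rfl fun j _ => ?_
      rw [huv]
      refine Finset.sum_congr rfl fun k _ => ?_
      rw [← LinearMap.adjoint_inner_left, TensorProduct.adjoint_map]
      simp

/-- Two different answers have total probability at most one. -/
theorem LOCCProtocol.answerProb_add_le {ι : Type} {dA dB : ℕ} (P : LOCCProtocol ι dA dB)
    {i j : ι} (hij : i ≠ j) (n : ℕ) : ∀ {a b : ℕ} (x : P.Node a b) (ψ : Bipartite a b),
      P.answerProb i n x ψ + P.answerProb j n x ψ ≤ ‖ψ‖ ^ 2 := by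
  induction n with
  | zero =>
    intro a b x ψ
    simp only [LOCCProtocol.answerProb]
    split_ifs with h1 h2 h2
    · exact absurd (h1.symm.trans h2) hij
    all_goals simp
  | succ n ih =>
    intro a b x ψ
    simp only [LOCCProtocol.answerProb]
    cases P.step x with
    | alice M next =>
      rw [← M.sum_norm_sq_map_left ψ, ← Finset.sum_add_distrib]
      exact Finset.sum_le_sum fun k _ => ih _ _
    | bob M next =>
      rw [← M.sum_norm_sq_map_right ψ, ← Finset.sum_add_distrib]
      exact Finset.sum_le_sum fun k _ => ih _ _

/-! ### Coordinates and the determinant criterion -/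

/-- The coordinates of a vector in the tensor product of the standard bases. -/
noncomputable def tensorCoord {dA dB : ℕ} (ψ : Bipartite dA dB) (i : Fin dA) (j : Fin dB) : ℂ :=
  ((EuclideanSpace.basisFun (Fin dA) ℂ).tensorProduct (EuclideanSpace.basisFun (Fin dB) ℂ)).repr
    ψ (i, j)

@[simp] theorem tensorCoord_tmul {dA dB : ℕ} (a : Qudit dA) (b : Qudit dB) (i : Fin dA)
    (j : Fin dB) : tensorCoord (a ⊗ₜ[ℂ] b) i j = a i * b j := by
  simp [tensorCoord, mul_comm]

@[simp] theorem tensorCoord_add {dA dB : ℕ} (ψ φ : Bipartite dA dB) (i : Fin dA) (j : Fin dB) :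
    tensorCoord (ψ + φ) i j = tensorCoord ψ i j + tensorCoord φ i j := by
  simp [tensorCoord]

@[simp] theorem tensorCoord_smul {dA dB : ℕ} (c : ℂ) (ψ : Bipartite dA dB) (i : Fin dA)
    (j : Fin dB) : tensorCoord (c • ψ) i j = c * tensorCoord ψ i j := by
  simp [tensorCoord]

theorem inner_eq_sum_tensorCoord {dA dB : ℕ} (ψ φ : Bipartite dA dB) :
    inner ℂ ψ φ = ∑ i, ∑ j, star (tensorCoord ψ i j) * tensorCoord φ i j := by
  rw [← LinearIsometryEquiv.inner_map_map ((EuclideanSpace.basisFun (Fin dA) ℂ).tensorProduct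
    (EuclideanSpace.basisFun (Fin dB) ℂ)).repr, PiLp.inner_apply, Fintype.sum_prod_type]
  simp [tensorCoord, mul_comm]

theorem tensorCoord_ext {dA dB : ℕ} {ψ φ : Bipartite dA dB}
    (h : ∀ i j, tensorCoord ψ i j = tensorCoord φ i j) : ψ = φ := by
  apply ((EuclideanSpace.basisFun (Fin dA) ℂ).tensorProduct
    (EuclideanSpace.basisFun (Fin dB) ℂ)).repr.injective
  ext ⟨i, j⟩
  exact h i j

/-- The determinant of the coordinate matrix of a two-qubit vector. -/
noncomputable def tensorDet (ψ : Bipartite 2 2) : ℂ :=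
  tensorCoord ψ 0 0 * tensorCoord ψ 1 1 - tensorCoord ψ 0 1 * tensorCoord ψ 1 0

/-- The polarization of the determinant. -/
noncomputable def tensorDetPolar (ψ φ : Bipartite 2 2) : ℂ :=
  tensorCoord ψ 0 0 * tensorCoord φ 1 1 + tensorCoord φ 0 0 * tensorCoord ψ 1 1
    - tensorCoord ψ 0 1 * tensorCoord φ 1 0 - tensorCoord φ 0 1 * tensorCoord ψ 1 0

/-- Product means rank at most one. Conversely, a nonzero first row serves as `b`, the second row
being a multiple of it; if the first row vanishes, the second row serves. -/
theorem isProductVec_iff_tensorDet (ψ : Bipartite 2 2) : IsProductVec ψ ↔ tensorDet ψ = 0 := by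
  constructor
  · rintro ⟨a, b, rfl⟩
    simp only [tensorDet, tensorCoord_tmul]
    ring
  · intro h
    rw [tensorDet, sub_eq_zero] at h
    by_cases h0 : tensorCoord ψ 0 0 = 0
    · by_cases h1 : tensorCoord ψ 0 1 = 0
      · refine ⟨!₂[0, 1], !₂[tensorCoord ψ 1 0, tensorCoord ψ 1 1], tensorCoord_ext ?_⟩
        simp [Fin.forall_fin_two, h0, h1]
      · refine ⟨!₂[1, tensorCoord ψ 1 1 / tensorCoord ψ 0 1],
          !₂[tensorCoord ψ 0 0, tensorCoord ψ 0 1], tensorCoord_ext ?_⟩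
        have : tensorCoord ψ 1 0 = 0 := by simpa [h0, h1] using h
        simp [Fin.forall_fin_two, h0, h1, this]
    · refine ⟨!₂[1, tensorCoord ψ 1 0 / tensorCoord ψ 0 0],
          !₂[tensorCoord ψ 0 0, tensorCoord ψ 0 1], tensorCoord_ext ?_⟩
      simp only [Fin.forall_fin_two, tensorCoord_tmul]
      refine ⟨⟨by simp, by simp⟩, by simp [h0], ?_⟩
      simp
      field_simp
      linear_combination h

theorem isProductVec_smul {dA dB : ℕ} {ψ : Bipartite dA dB} (c : ℂ) (h : IsProductVec ψ) :
    IsProductVec (c • ψ) := by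
  obtain ⟨a, b, rfl⟩ := h
  exact ⟨c • a, b, TensorProduct.smul_tmul' c a b⟩

/-! ### Subspaces of product vectors -/

/-- A subspace in which every pure state is a product state consists of product vectors. -/
theorem isProductVec_of_forall_unit {dA dB : ℕ} {V : Submodule ℂ (Bipartite dA dB)}
    (hV : ∀ φ ∈ V, ‖φ‖ = 1 → IsProductVec φ) {φ : Bipartite dA dB} (hφ : φ ∈ V) :
    IsProductVec φ := by
  by_cases h0 : φ = 0
  · exact ⟨0, 0, by simp [h0]⟩
  · have h := isProductVec_smul (‖φ‖ : ℂ) (hV ((‖φ‖⁻¹ : ℂ) • φ) (V.smul_mem _ hφ)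
      (norm_smul_inv_norm h0))
    rwa [smul_smul, mul_inv_cancel₀ (by simpa using h0), one_smul] at h

theorem exists_smul_of_cross_eq_zero {a c : Qudit 2} (ha : a ≠ 0)
    (h : a 0 * c 1 = a 1 * c 0) : ∃ t : ℂ, c = t • a := by
  by_cases h0 : a 0 = 0
  · have h1 : a 1 ≠ 0 := fun h1 => ha (by ext i; fin_cases i <;> simp [h0, h1])
    have hc : c 0 = 0 := by simpa [h0, h1] using h
    refine ⟨c 1 / a 1, ?_⟩
    ext i
    fin_cases i <;> simp [h0, h1, hc]
  · refine ⟨c 0 / a 0, ?_⟩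
    ext i
    fin_cases i
    · simp [h0]
    · simp
      field_simp
      linear_combination h

/-- A system of two homogeneous linear equations with a nonzero determinant is trivial. -/
theorem eq_zero_of_cross_ne_zero {b d : Qudit 2} (h : b 0 * d 1 ≠ b 1 * d 0) {y₀ y₁ : ℂ}
    (hb : y₀ * b 0 + y₁ * b 1 = 0) (hd : y₀ * d 0 + y₁ * d 1 = 0) : y₀ = 0 ∧ y₁ = 0 := by
  have h' := sub_ne_zero.2 h
  constructor
  · refine (mul_eq_zero.1 ?_).resolve_right h'
    linear_combination d 1 * hb - b 1 * hd
  · refine (mul_eq_zero.1 ?_).resolve_right h'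
    linear_combination b 0 * hd - d 0 * hb

/-- A vector orthogonal to two linearly independent vectors spanning a space of product vectors is
itself a product vector. -/
theorem isProductVec_of_inner_eq_zero {v w ψ : Bipartite 2 2} (hvw : inner ℂ v w = 0)
    (hv0 : v ≠ 0) (hw0 : w ≠ 0) (hv : IsProductVec v) (hw : IsProductVec w)
    (hadd : IsProductVec (v + w)) (hψv : inner ℂ ψ v = 0) (hψw : inner ℂ ψ w = 0) :
    IsProductVec ψ := by
  obtain ⟨a, b, rfl⟩ := hv
  obtain ⟨c, d, rfl⟩ := hw
  have ha : a ≠ 0 := by rintro rfl; simp at hv0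
  have hb : b ≠ 0 := by rintro rfl; simp at hv0
  have hc : c ≠ 0 := by rintro rfl; simp at hw0
  have hd : d ≠ 0 := by rintro rfl; simp at hw0
  rw [isProductVec_iff_tensorDet] at hadd ⊢
  simp only [tensorDet, tensorCoord_add, tensorCoord_tmul] at hadd
  -- The determinant of `a ⊗ b + c ⊗ d` factors into the two cross products.
  have hcross : (a 0 * c 1 - a 1 * c 0) * (b 0 * d 1 - b 1 * d 0) = 0 := by
    linear_combination hadd
  rw [inner_eq_sum_tensorCoord] at hψv hψw
  simp only [Fin.sum_univ_two, tensorCoord_tmul] at hψv hψw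
  rw [TensorProduct.inner_tmul] at hvw
  have hdet (h : star (tensorCoord ψ 0 0) * star (tensorCoord ψ 1 1)
      = star (tensorCoord ψ 0 1) * star (tensorCoord ψ 1 0)) : tensorDet ψ = 0 := by
    rw [tensorDet, sub_eq_zero]
    apply star_injective
    simpa using h
  apply hdet
  rcases mul_eq_zero.1 hcross with h | h
  · obtain ⟨t, rfl⟩ := exists_smul_of_cross_eq_zero ha (sub_eq_zero.1 h)
    have ht : t ≠ 0 := by rintro rfl; simp at hc
    -- Were both pairs parallel, the two product vectors would be proportional, against
    -- orthogonality.
    have hbd : b 0 * d 1 ≠ b 1 * d 0 := by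
      intro hbd
      obtain ⟨s, rfl⟩ := exists_smul_of_cross_eq_zero hb hbd
      simp [inner_smul_right, ht, ha, hb] at hvw
      simp [hvw] at hd
    have h2 : t * ((star (tensorCoord ψ 0 0) * a 0 + star (tensorCoord ψ 1 0) * a 1) * d 0
        + (star (tensorCoord ψ 0 1) * a 0 + star (tensorCoord ψ 1 1) * a 1) * d 1) = 0 := by
      simp only [PiLp.smul_apply, smul_eq_mul] at hψw
      linear_combination hψw
    obtain ⟨h3, h4⟩ := eq_zero_of_cross_ne_zero hbd (by linear_combination hψv)
      ((mul_eq_zero.1 h2).resolve_left ht)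
    -- The nonzero vector `a` is annihilated by the transposed conjugate coordinates of `ψ`, so
    -- their determinant vanishes.
    by_contra hne
    obtain ⟨h5, h6⟩ := eq_zero_of_cross_ne_zero
      (b := !₂[star (tensorCoord ψ 0 0), star (tensorCoord ψ 1 0)])
      (d := !₂[star (tensorCoord ψ 0 1), star (tensorCoord ψ 1 1)])
      (y₀ := a 0) (y₁ := a 1) (by simpa [mul_comm] using hne)
      (by simpa [mul_comm] using h3) (by simpa [mul_comm] using h4)
    exact ha (by ext i; fin_cases i <;> simp [h5, h6])
  · obtain ⟨t, rfl⟩ := exists_smul_of_cross_eq_zero hb (sub_eq_zero.1 h)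
    have ht : t ≠ 0 := by rintro rfl; simp at hd
    have hac : a 0 * c 1 ≠ a 1 * c 0 := by
      intro hac
      obtain ⟨s, rfl⟩ := exists_smul_of_cross_eq_zero ha hac
      simp [inner_smul_right, ht, ha, hb] at hvw
      simp [hvw] at hc
    have h2 : t * ((star (tensorCoord ψ 0 0) * b 0 + star (tensorCoord ψ 0 1) * b 1) * c 0
        + (star (tensorCoord ψ 1 0) * b 0 + star (tensorCoord ψ 1 1) * b 1) * c 1) = 0 := by
      simp only [PiLp.smul_apply, smul_eq_mul] at hψw
      linear_combination hψw
    obtain ⟨h3, h4⟩ := eq_zero_of_cross_ne_zero hac (by linear_combination hψv)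
      ((mul_eq_zero.1 h2).resolve_left ht)
    by_contra hne
    obtain ⟨h5, h6⟩ := eq_zero_of_cross_ne_zero
      (b := !₂[star (tensorCoord ψ 0 0), star (tensorCoord ψ 0 1)])
      (d := !₂[star (tensorCoord ψ 1 0), star (tensorCoord ψ 1 1)])
      (y₀ := b 0) (y₁ := b 1) (by simpa [mul_comm] using hne)
      (by simpa [mul_comm] using h3) (by simpa [mul_comm] using h4)
    exact hb (by ext i; fin_cases i <;> simp [h5, h6])

/-- If a subspace of dimension at least two contains only product vectors, then so does its
orthogonal complement. -/
theorem isProductVec_of_mem_orthogonal {V : Submodule ℂ (Bipartite 2 2)}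
    (hV : ∀ φ ∈ V, ‖φ‖ = 1 → IsProductVec φ) (hdim : 2 ≤ Module.finrank ℂ V)
    {ψ : Bipartite 2 2} (hψ : ψ ∈ Vᗮ) : IsProductVec ψ := by
  let b := stdOrthonormalBasis ℂ V
  let i : Fin (Module.finrank ℂ V) := ⟨0, by omega⟩
  let j : Fin (Module.finrank ℂ V) := ⟨1, by omega⟩
  have hij : i ≠ j := by simp [i, j]
  have hprod {φ : Bipartite 2 2} (hφ : φ ∈ V) : IsProductVec φ := isProductVec_of_forall_unit hV hφ
  have hne (k) : (b k : Bipartite 2 2) ≠ 0 := by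
    simpa using b.orthonormal.ne_zero k
  exact isProductVec_of_inner_eq_zero (v := b i) (w := b j)
    (by simpa using b.orthonormal.2 hij) (hne i) (hne j) (hprod (b i).2) (hprod (b j).2)
    (hprod (V.add_mem (b i).2 (b j).2)) (V.inner_left_of_mem_orthogonal (b i).2 hψ)
    (V.inner_left_of_mem_orthogonal (b j).2 hψ)

/-! ### Quantitative estimates for separable effects -/

/-- Effects that sum up to at most the identity have small coherences between a state that is
detected almost surely and an orthogonal state. -/
theorem norm_sum_inner_mul_inner_sq_le {E κ : Type*} [NormedAddCommGroup E]
    [InnerProductSpace ℂ E] [Fintype κ] {w : κ → E}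
    (hw : ∀ φ : E, ∑ k, ‖inner ℂ (w k) φ‖ ^ 2 ≤ ‖φ‖ ^ 2) {u v : E} (hu : ‖u‖ = 1) (hv : ‖v‖ = 1)
    (huv : inner ℂ u v = 0) :
    ‖∑ k, inner ℂ u (w k) * star (inner ℂ v (w k))‖ ^ 2
      ≤ 1 - ∑ k, ‖inner ℂ v (w k)‖ ^ 2 := by
  set c := ∑ k, inner ℂ u (w k) * star (inner ℂ v (w k)) with hc
  -- Taking the coherence `c` itself as coefficient yields `Q + 2|c|² + |c|² P ≤ 1 + |c|²`, with
  -- `P`, `Q` the weights of `u`, `v`.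
  have h := hw (v + c • u)
  have hnorm : ‖v + c • u‖ ^ 2 = 1 + ‖c‖ ^ 2 := by
    have h0 : inner ℂ v (c • u) = 0 := by
      rw [inner_smul_right, ← inner_conj_symm, huv]; simp
    have := norm_add_sq_eq_norm_sq_add_norm_sq_of_inner_eq_zero v (c • u) h0
    rw [pow_two, this, norm_smul, hu, hv]; ring
  have hterm (k : κ) : ‖inner ℂ (w k) (v + c • u)‖ ^ 2 = ‖inner ℂ v (w k)‖ ^ 2
      + 2 * (star c * (inner ℂ u (w k) * star (inner ℂ v (w k)))).re
      + ‖c‖ ^ 2 * ‖inner ℂ u (w k)‖ ^ 2 := by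
    rw [inner_add_right, inner_smul_right, ← inner_conj_symm (w k) v, ← inner_conj_symm (w k) u]
    generalize inner ℂ u (w k) = x
    generalize inner ℂ v (w k) = y
    simp only [← Complex.normSq_eq_norm_sq, Complex.normSq_apply]
    simp
    ring
  have hP : 0 ≤ ∑ k, ‖inner ℂ u (w k)‖ ^ 2 := Finset.sum_nonneg fun _ _ => by positivity
  have hcc : (star c * c).re = ‖c‖ ^ 2 := by
    rw [← Complex.normSq_eq_norm_sq, Complex.normSq_apply]; simp
  simp only [hterm, hnorm, Finset.sum_add_distrib, ← Finset.mul_sum, ← Complex.re_sum,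
    ← hc, hcc] at h
  nlinarith [mul_nonneg (sq_nonneg ‖c‖) hP]

/-- Both `q (α q + β p) = -z` and `q̄ (α q + β p)` have the same modulus. This trades `q ^ 2` for
`|q| ^ 2`, which can be summed without cancellation. -/
theorem norm_add_mul_star_le {α β p q z : ℂ} (h : α * q ^ 2 + β * p * q + z = 0) :
    ‖α * (‖q‖ ^ 2 : ℝ) + β * (p * star q)‖ ≤ ‖z‖ := by
  by_cases hq : q = 0
  · simp [hq]
  · have hq' : 0 < ‖q‖ := norm_pos_iff.2 hq
    refine le_of_eq (mul_right_cancel₀ hq'.ne' ?_)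
    rw [← norm_mul, ← norm_star q, ← norm_mul, ← norm_neg (z * star q)]
    congr 1
    have : ((‖q‖ ^ 2 : ℝ) : ℂ) = q * star q := by
      rw [← Complex.normSq_eq_norm_sq, ← Complex.mul_conj]; rfl
    rw [norm_star, this]
    linear_combination star q * h

theorem sum_norm_mul_norm_le {κ : Type*} [Fintype κ] (r p : κ → ℂ) (hp : ∑ k, ‖p k‖ ^ 2 ≤ 1) :
    ∑ k, ‖r k‖ * ‖p k‖ ≤ √(∑ k, ‖r k‖ ^ 2) := by
  refine (Real.sum_mul_le_sqrt_mul_sqrt _ _ _).trans ?_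
  exact mul_le_of_le_one_right (Real.sqrt_nonneg _) (Real.sqrt_le_one.2 hp)

/-- Families of coordinates on which a quadratic form without `p ^ 2` term vanishes: the coefficient
of `q ^ 2` is controlled by the coherence of `p` and `q` and by the weights of `r` and `s`. -/
theorem norm_mul_sum_sq_le_of_quadratic {κ : Type*} [Fintype κ] {p q r s : κ → ℂ}
    {α β γ₀ γ₁ γ₂ δ₀ δ₁ δ₂ δ₃ : ℂ}
    (h : ∀ k, α * q k ^ 2 + β * p k * q k + (r k * (γ₀ * p k + γ₁ * q k + γ₂ * r k)
      + s k * (δ₀ * p k + δ₁ * q k + δ₂ * r k + δ₃ * s k)) = 0)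
    (hp : ∑ k, ‖p k‖ ^ 2 ≤ 1) (hq : ∑ k, ‖q k‖ ^ 2 ≤ 1) (hr : ∑ k, ‖r k‖ ^ 2 ≤ 1)
    (hs : ∑ k, ‖s k‖ ^ 2 ≤ 1) :
    ‖α‖ * ∑ k, ‖q k‖ ^ 2 ≤ ‖β‖ * ‖∑ k, p k * star (q k)‖
      + ((‖γ₀‖ + ‖γ₁‖ + ‖γ₂‖) * √(∑ k, ‖r k‖ ^ 2)
        + (‖δ₀‖ + ‖δ₁‖ + ‖δ₂‖ + ‖δ₃‖) * √(∑ k, ‖s k‖ ^ 2)) := by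
  have hQ : 0 ≤ ∑ k, ‖q k‖ ^ 2 := Finset.sum_nonneg fun _ _ => by positivity
  have h1 : ‖α * ((∑ k, ‖q k‖ ^ 2 : ℝ) : ℂ) + β * ∑ k, p k * star (q k)‖
      ≤ (‖γ₀‖ + ‖γ₁‖ + ‖γ₂‖) * √(∑ k, ‖r k‖ ^ 2)
        + (‖δ₀‖ + ‖δ₁‖ + ‖δ₂‖ + ‖δ₃‖) * √(∑ k, ‖s k‖ ^ 2) := by
    -- Every remainder term carries a factor `r` or `s`, so Cauchy–Schwarz bounds its sum by the
    -- root of that weight.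
    rw [Complex.ofReal_sum, Finset.mul_sum, Finset.mul_sum, ← Finset.sum_add_distrib]
    refine (norm_sum_le _ _).trans ((Finset.sum_le_sum fun k _ => norm_add_mul_star_le (h k)).trans
      ((Finset.sum_le_sum (g := fun k => (‖γ₀‖ * (‖r k‖ * ‖p k‖) + ‖γ₁‖ * (‖r k‖ * ‖q k‖)
        + ‖γ₂‖ * (‖r k‖ * ‖r k‖)) + (‖δ₀‖ * (‖s k‖ * ‖p k‖) + ‖δ₁‖ * (‖s k‖ * ‖q k‖)
        + ‖δ₂‖ * (‖s k‖ * ‖r k‖) + ‖δ₃‖ * (‖s k‖ * ‖s k‖))) fun k _ => ?_).trans ?_))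
    · have e1 : ‖γ₀ * p k + γ₁ * q k + γ₂ * r k‖ ≤ ‖γ₀‖ * ‖p k‖ + ‖γ₁‖ * ‖q k‖ + ‖γ₂‖ * ‖r k‖ := by
        simpa only [norm_mul] using norm_add₃_le (a := γ₀ * p k) (b := γ₁ * q k) (c := γ₂ * r k)
      have e2 : ‖δ₀ * p k + δ₁ * q k + δ₂ * r k + δ₃ * s k‖
          ≤ ‖δ₀‖ * ‖p k‖ + ‖δ₁‖ * ‖q k‖ + ‖δ₂‖ * ‖r k‖ + ‖δ₃‖ * ‖s k‖ := by
        simpa only [norm_mul] using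
          norm_add₄_le (a := δ₀ * p k) (b := δ₁ * q k) (c := δ₂ * r k) (d := δ₃ * s k)
      refine (norm_add_le _ _).trans ?_
      rw [norm_mul, norm_mul]
      linarith [mul_le_mul_of_nonneg_left e1 (norm_nonneg (r k)),
        mul_le_mul_of_nonneg_left e2 (norm_nonneg (s k))]
    · simp only [Finset.sum_add_distrib, ← Finset.mul_sum, add_mul]
      gcongr
      all_goals exact sum_norm_mul_norm_le _ _ (by assumption)
  have h2 : ‖α‖ * ∑ k, ‖q k‖ ^ 2 = ‖α * ((∑ k, ‖q k‖ ^ 2 : ℝ) : ℂ)‖ := by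
    rw [norm_mul, Complex.norm_of_nonneg hQ]
  rw [h2, ← norm_mul]
  have h3 := norm_sub_le (α * ((∑ k, ‖q k‖ ^ 2 : ℝ) : ℂ) + β * ∑ k, p k * star (q k))
    (β * ∑ k, p k * star (q k))
  rw [add_sub_cancel_right] at h3
  linarith

/-- Separable effects cannot converge to an effect that detects with certainty one entangled
element of an orthonormal basis and excludes two others, if the last basis element is product. -/
theorem tensorDet_eq_zero_of_tendsto (b : OrthonormalBasis (Fin 4) ℂ (Bipartite 2 2))
    (hb : tensorDet (b 0) = 0) (f : ℕ → Bipartite 2 2 → ℝ)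
    (hf : ∀ n, ∃ (κ : Type) (_ : Fintype κ) (u v : κ → Qudit 2), ∀ φ,
      f n φ = ∑ k, ‖inner ℂ (u k ⊗ₜ[ℂ] v k) φ‖ ^ 2)
    (hle : ∀ n φ, f n φ ≤ ‖φ‖ ^ 2)
    (h1 : Filter.Tendsto (fun n => f n (b 1)) Filter.atTop (nhds 1))
    (h2 : Filter.Tendsto (fun n => f n (b 2)) Filter.atTop (nhds 0))
    (h3 : Filter.Tendsto (fun n => f n (b 3)) Filter.atTop (nhds 0)) : tensorDet (b 1) = 0 := by
  let D : Fin 4 → Fin 4 → ℂ := fun i j => tensorDetPolar (b i) (b j)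
  have key (n : ℕ) : ‖tensorDet (b 1)‖ * f n (b 1) ≤ ‖D 0 1‖ * √(1 - f n (b 1))
      + ((‖D 0 2‖ + ‖D 1 2‖ + ‖tensorDet (b 2)‖) * √(f n (b 2))
        + (‖D 0 3‖ + ‖D 1 3‖ + ‖D 2 3‖ + ‖tensorDet (b 3)‖) * √(f n (b 3))) := by
    obtain ⟨κ, _, u, v, huv⟩ := hf n
    have hsum (φ : Bipartite 2 2) : ∑ k, ‖inner ℂ φ (u k ⊗ₜ[ℂ] v k)‖ ^ 2 = f n φ := by
      rw [huv]
      exact Finset.sum_congr rfl fun k _ => by rw [norm_inner_symm (𝕜 := ℂ) φ]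
    have hone (i) : ∑ k, ‖inner ℂ (b i) (u k ⊗ₜ[ℂ] v k)‖ ^ 2 ≤ 1 := by
      rw [hsum]
      simpa using hle n (b i)
    -- This is the determinant of a product vector expanded in the basis `b`; the `p ^ 2` term is
    -- absent because of `hb`.
    have hquad (k : κ) : tensorDet (b 1) * inner ℂ (b 1) (u k ⊗ₜ[ℂ] v k) ^ 2
        + D 0 1 * inner ℂ (b 0) (u k ⊗ₜ[ℂ] v k) * inner ℂ (b 1) (u k ⊗ₜ[ℂ] v k)
        + (inner ℂ (b 2) (u k ⊗ₜ[ℂ] v k) * (D 0 2 * inner ℂ (b 0) (u k ⊗ₜ[ℂ] v k)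
            + D 1 2 * inner ℂ (b 1) (u k ⊗ₜ[ℂ] v k)
            + tensorDet (b 2) * inner ℂ (b 2) (u k ⊗ₜ[ℂ] v k))
          + inner ℂ (b 3) (u k ⊗ₜ[ℂ] v k) * (D 0 3 * inner ℂ (b 0) (u k ⊗ₜ[ℂ] v k)
            + D 1 3 * inner ℂ (b 1) (u k ⊗ₜ[ℂ] v k) + D 2 3 * inner ℂ (b 2) (u k ⊗ₜ[ℂ] v k)
            + tensorDet (b 3) * inner ℂ (b 3) (u k ⊗ₜ[ℂ] v k))) = 0 := by
      have hdet := (isProductVec_iff_tensorDet (u k ⊗ₜ[ℂ] v k)).1 ⟨_, _, rfl⟩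
      rw [← b.sum_repr' (u k ⊗ₜ[ℂ] v k), Fin.sum_univ_four] at hdet
      generalize inner ℂ (b 0) (u k ⊗ₜ[ℂ] v k) = p at hdet ⊢
      generalize inner ℂ (b 1) (u k ⊗ₜ[ℂ] v k) = q at hdet ⊢
      generalize inner ℂ (b 2) (u k ⊗ₜ[ℂ] v k) = r at hdet ⊢
      generalize inner ℂ (b 3) (u k ⊗ₜ[ℂ] v k) = s at hdet ⊢
      simp only [tensorDet, tensorCoord_add, tensorCoord_smul] at hdet hb
      simp only [D, tensorDet, tensorDetPolar]
      linear_combination hdet - p ^ 2 * hb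
    have hmain := norm_mul_sum_sq_le_of_quadratic hquad (hone 0) (hone 1) (hone 2) (hone 3)
    -- The weight on `b 0` is uncontrolled; only its coherence with `b 1` is small.
    have hcross := norm_sum_inner_mul_inner_sq_le (w := fun k => u k ⊗ₜ[ℂ] v k)
      (fun φ => by rw [← huv]; exact hle n φ) (b.orthonormal.1 0) (b.orthonormal.1 1)
      (b.orthonormal.2 (by decide))
    simp only [hsum] at hmain hcross
    refine hmain.trans ?_
    gcongr
    exact Real.le_sqrt_of_sq_le hcross
  have hL := h1.const_mul ‖tensorDet (b 1)‖
  have hR := (((h1.const_sub 1).sqrt).const_mul ‖D 0 1‖).add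
    ((h2.sqrt.const_mul (‖D 0 2‖ + ‖D 1 2‖ + ‖tensorDet (b 2)‖)).add
      (h3.sqrt.const_mul (‖D 0 3‖ + ‖D 1 3‖ + ‖D 2 3‖ + ‖tensorDet (b 3)‖)))
  simpa using le_of_tendsto_of_tendsto' hL hR key

/-! ### Dimension counts and conclusion -/

theorem finrank_bipartite (dA dB : ℕ) : Module.finrank ℂ (Bipartite dA dB) = dA * dB := by
  simp

theorem IsOrthogonalEntangledSet.orthonormal {dA dB : ℕ} {S : Set (Bipartite dA dB)}
    (hS : IsOrthogonalEntangledSet S) : Orthonormal ℂ ((↑) : S → Bipartite dA dB) :=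
  ⟨fun ψ => (hS.entangled ψ ψ.2).1,
    fun {ψ φ} h => hS.orthogonal ψ ψ.2 φ φ.2 (Subtype.coe_injective.ne h)⟩

/-- Finiteness matters because `Set.ncard` is zero on infinite sets. -/
theorem IsOrthogonalEntangledSet.finite {dA dB : ℕ} {S : Set (Bipartite dA dB)}
    (hS : IsOrthogonalEntangledSet S) : S.Finite :=
  hS.orthonormal.linearIndependent.setFinite

theorem IsOrthogonalEntangledSet.finrank_span {dA dB : ℕ} {S : Set (Bipartite dA dB)}
    (hS : IsOrthogonalEntangledSet S) : Module.finrank ℂ (Submodule.span ℂ S) = S.ncard := by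
  have := hS.finite.fintype
  rw [finrank_span_set_eq_card hS.orthonormal.linearIndependent, Set.ncard_eq_toFinset_card']

/-- At most two mutually orthogonal entangled two-qubit states, and at least one: some entangled
state is orthogonal to all of them. -/
theorem IsOrthogonalEntangledSet.exists_isEntangledState {S : Set (Bipartite 2 2)}
    (hS : IsOrthogonalEntangledSet S) (hne : S.Nonempty) (hcard : S.ncard ≤ 2) :
    ∃ φ ∈ (Submodule.span ℂ S)ᗮ, IsEntangledState φ := by
  by_contra! hcon
  have hV : ∀ φ ∈ (Submodule.span ℂ S)ᗮ, ‖φ‖ = 1 → IsProductVec φ := fun φ hφ h1 => by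
    by_contra h2
    exact hcon φ hφ ⟨h1, h2⟩
  have hdim := (Submodule.span ℂ S).finrank_add_finrank_orthogonal
  rw [hS.finrank_span, finrank_bipartite] at hdim
  obtain ⟨ψ, hψ⟩ := hne
  exact (hS.entangled ψ hψ).2 (isProductVec_of_mem_orthogonal hV (by omega)
    (Submodule.le_orthogonal_orthogonal _ (Submodule.subset_span hψ)))

/-- The complement of the empty set is the whole space, which contains an unnormalised Bell vector
of determinant one. -/
theorem IsUnextendibleEntangledBasis.nonempty {S : Set (Bipartite 2 2)}
    (hS : IsUnextendibleEntangledBasis S) : S.Nonempty := by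
  by_contra h
  rw [Set.not_nonempty_iff_eq_empty] at h
  subst h
  have hprod := isProductVec_of_forall_unit hS.unextendible
    (φ := !₂[1, 0] ⊗ₜ[ℂ] !₂[1, 0] + !₂[0, 1] ⊗ₜ[ℂ] !₂[0, 1]) (by simp)
  rw [isProductVec_iff_tensorDet] at hprod
  simp [tensorDet] at hprod

theorem IsUnextendibleEntangledBasis.ncard_eq_three {S : Set (Bipartite 2 2)}
    (hS : IsUnextendibleEntangledBasis S) : S.ncard = 3 := by
  have h1 : 2 < S.ncard := by
    by_contra! h
    obtain ⟨φ, hφ, hent⟩ :=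
      hS.toIsOrthogonalEntangledSet.exists_isEntangledState hS.nonempty h
    exact hent.2 (hS.unextendible φ hφ hent.1)
  have h2 := Submodule.finrank_lt hS.proper
  rw [hS.toIsOrthogonalEntangledSet.finrank_span, finrank_bipartite] at h2
  omega

/-- An unextendible entangled basis has a complementary product state. -/
theorem IsUnextendibleEntangledBasis.exists_product {dA dB : ℕ} {S : Set (Bipartite dA dB)}
    (hS : IsUnextendibleEntangledBasis S) :
    ∃ φ ∈ (Submodule.span ℂ S)ᗮ, ‖φ‖ = 1 ∧ IsProductVec φ := by
  have hbot : (Submodule.span ℂ S)ᗮ ≠ ⊥ := by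
    rw [Ne, Submodule.orthogonal_eq_bot_iff]
    exact hS.proper
  obtain ⟨φ, hφ, h0⟩ := Submodule.exists_mem_ne_zero_of_ne_bot hbot
  have hmem := Submodule.smul_mem _ (‖φ‖⁻¹ : ℂ) hφ
  have hnorm : ‖(‖φ‖⁻¹ : ℂ) • φ‖ = 1 := norm_smul_inv_norm h0
  exact ⟨_, hmem, hnorm, hS.unextendible _ hmem hnorm⟩

theorem IsUnextendibleEntangledBasis.not_loccPerfectlyDistinguishable {S : Set (Bipartite 2 2)}
    (hS : IsUnextendibleEntangledBasis S) : ¬ LOCCPerfectlyDistinguishable S := by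
  rintro ⟨P, hP⟩
  obtain ⟨φ, hφ, hφ1, hφprod⟩ := hS.exists_product
  obtain ⟨x, y, z, hxy, hxz, hyz, hSxyz⟩ := Set.ncard_eq_three.1 hS.ncard_eq_three
  have hx : x ∈ S := by simp [hSxyz]
  have hy : y ∈ S := by simp [hSxyz]
  have hz : z ∈ S := by simp [hSxyz]
  have hφS (ψ) (hψ : ψ ∈ S) : inner ℂ φ ψ = 0 :=
    Submodule.inner_left_of_mem_orthogonal (Submodule.subset_span hψ) hφ
  have hSφ (ψ) (hψ : ψ ∈ S) : inner ℂ ψ φ = 0 :=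
    Submodule.inner_right_of_mem_orthogonal (Submodule.subset_span hψ) hφ
  have hon : Orthonormal ℂ ![φ, x, y, z] := by
    refine ⟨fun i => ?_, fun i j hij => ?_⟩
    · fin_cases i
      exacts [hφ1, (hS.entangled x hx).1, (hS.entangled y hy).1, (hS.entangled z hz).1]
    · fin_cases i <;> fin_cases j
      exacts [absurd rfl hij, hφS x hx, hφS y hy, hφS z hz, hSφ x hx, absurd rfl hij,
        hS.orthogonal x hx y hy hxy, hS.orthogonal x hx z hz hxz, hSφ y hy,
        hS.orthogonal y hy x hx hxy.symm, absurd rfl hij, hS.orthogonal y hy z hz hyz, hSφ z hz,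
        hS.orthogonal z hz x hx hxz.symm, hS.orthogonal z hz y hy hyz.symm, absurd rfl hij]
  have hspan : ⊤ ≤ Submodule.span ℂ (Set.range ![φ, x, y, z]) := by
    rw [hon.linearIndependent.span_eq_top_of_card_eq_finrank (by simp)]
  let b := OrthonormalBasis.mk hon hspan
  have hb : ⇑b = ![φ, x, y, z] := OrthonormalBasis.coe_mk hon hspan
  have hnonneg (i : S) (n : ℕ) (ψ : Bipartite 2 2) : 0 ≤ P.answerProb i n P.start ψ := by
    obtain ⟨κ, _, u, v, h⟩ := P.exists_product_family i n P.start
    rw [h]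
    exact Finset.sum_nonneg fun _ _ => by positivity
  -- On input `ψ` the correct answer takes up all the probability in the limit, leaving none for
  -- `x`.
  have hzero (ψ) (hψ : ψ ∈ S) (hne : x ≠ ψ) :
      Filter.Tendsto (fun n => P.answerProb ⟨x, hx⟩ n P.start ψ) Filter.atTop (nhds 0) := by
    refine squeeze_zero (g := fun n => 1 - P.answerProb ⟨ψ, hψ⟩ n P.start ψ)
      (fun n => hnonneg _ _ _) (fun n => ?_) ?_
    · have := P.answerProb_add_le (i := ⟨x, hx⟩) (j := ⟨ψ, hψ⟩)
        (fun h => hne (congrArg Subtype.val h)) n P.start ψ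
      rw [(hS.entangled ψ hψ).1] at this
      linarith
    · simpa using (hP ⟨ψ, hψ⟩).const_sub 1
  refine (hS.entangled x hx).2 ((isProductVec_iff_tensorDet x).2 ?_)
  have := tensorDet_eq_zero_of_tendsto b (by simpa [hb] using (isProductVec_iff_tensorDet φ).1 hφprod)
    (fun n ψ => P.answerProb ⟨x, hx⟩ n P.start ψ) (fun n => P.exists_product_family _ n P.start)
    (fun n ψ => by
      have := P.answerProb_add_le (i := ⟨x, hx⟩) (j := ⟨y, hy⟩)
        (fun h => hxy (congrArg Subtype.val h)) n P.start ψ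
      linarith [hnonneg ⟨y, hy⟩ n ψ])
    (by simpa [hb] using hP ⟨x, hx⟩) (by simpa [hb] using hzero y hy hxy)
    (by simpa [hb] using hzero z hz hxz)
  simpa [hb] using this

theorem proposition1 :
    (∀ S : Set (Bipartite 2 2), IsUnextendibleEntangledBasis S →
      S.ncard = 3 ∧ ¬ LOCCPerfectlyDistinguishable S) ∧
    (∀ S : Set (Bipartite 2 2), IsOrthogonalEntangledSet S → (S.ncard = 1 ∨ S.ncard = 2) →
      ∃ φ ∈ (Submodule.span ℂ S)ᗮ, IsEntangledState φ) :=
  ⟨fun _ hS => ⟨hS.ncard_eq_three, hS.not_loccPerfectlyDistinguishable⟩,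
    fun _ hS h => hS.exists_isEntangledState (Set.nonempty_of_ncard_ne_zero (by omega)) (by omega)⟩
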